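/- For real $q$ with $|q|<1$ let $$\varphi(q)=\sum_{k=-\infty}^{\infty}q^{k^2},\qquad \chi(q)=\prod_{k=0}^{\infty}\bigl(1+q^{2k+1}\bigr),$$ and for $n>0$ let $G_n$ be the Ramanujan class invariant $$G_n=2^{-1/4}q^{-1/24}\chi(q),\qquad q=e^{-\pi\sqrt n}.$$ For $p>0$ define $$s(p)=\frac15\Bigl(1+\Bigl\{\tfrac p2\bigl((p-1)^2+7+(4-p)\sqrt{4+p^2}\bigr)\Bigr\}^{1/5}+\Bigl\{\tfrac p2\bigl((p-1)^2+7-(4-p)\sqrt{4+p^2}\bigr)\Bigr\}^{1/5}\Bigr),$$ where the fifth roots are the real ones (both numbers in braces are positive). Then for every positive rational number $n$, $$\frac{\varphi(e^{-25\pi\sqrt n})}{\varphi(e^{-\pi\sqrt n})}=s(p)\qquad\text{with}\qquad p=\frac{2G_{25n}}{G_n^5}.$$ -/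

import Mathlib

namespace RamanujanTheta

noncomputable section

/-- Ramanujan's theta function `φ(q) = ∑_{k ∈ ℤ} q^(k²)`, for real `q` with `|q| < 1`. -/
def phi (q : ℝ) : ℝ := ∑' k : ℤ, q ^ (k ^ 2)

/-- The infinite product `(a; q)_∞ = ∏_{k ≥ 0} (1 - a q^k)`, for real `a`, `q` with `|q| < 1`. -/
def qPochhammerInf (a q : ℝ) : ℝ := ∏' k : ℕ, (1 - a * q ^ k)

/-- Ramanujan's function `χ(q) = (-q; q²)_∞`, for real `q` with `|q| < 1`. -/
def chi (q : ℝ) : ℝ := qPochhammerInf (-q) (q ^ 2)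

/-- The Ramanujan class invariant `G_n = 2^(-1/4) q^(-1/24) χ(q)` with `q = e^(-π √n)`,
for `n > 0`. -/
def classInvariant (n : ℝ) : ℝ :=
  (2 : ℝ) ^ (-(1 / 4) : ℝ) * Real.exp (-Real.pi * √n) ^ (-(1 / 24) : ℝ) *
    chi (Real.exp (-Real.pi * √n))

/-- The function `s(p)`. For `p > 0` both numbers under the fifth roots are positive. -/
def s (p : ℝ) : ℝ :=
  (1 / 5) * (1
    + (p / 2 * ((p - 1) ^ 2 + 7 + (4 - p) * √(4 + p ^ 2))) ^ (1 / 5 : ℝ)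
    + (p / 2 * ((p - 1) ^ 2 + 7 - (4 - p) * √(4 + p ^ 2))) ^ (1 / 5 : ℝ))

end

end RamanujanTheta

namespace RamanujanTheta

open Filter Topology

noncomputable section

/-! Put `t = √n`, `Q = e^(-π/(25t))`, `x = Q^5`. Inverting `φ` at `25t` and at `t` turns the
quotient into `φ(Q) / (5 φ(Q^25))`, and the invariance of `q^(-1/24) χ(q)` under `t ↦ 1/t`
(`chiNorm_inv`) turns `p` into `4 x χ(x) / χ(x^5)^5`.

Splitting `φ(Q)` by residues mod 5 gives `φ(Q) / φ(Q^25) = 1 + u + v`, where `u`, `v` carry the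
exponents `≡ 1, 4` mod 5 (`theta_one_dissection`). The triple product gives `uv = p`
(`theta_mul_theta_mul_poch`). Multiplying the dissection over `Q ↦ ζ^j Q`, `ζ^5 = 1`, gives `1 + u^5
+ v^5 - 5uv + 5(uv)^2 = (φ(x)/φ(x^5))^6` (`theta_one_pow_six`), and counting in `ℤ[i]` modulo `2 +
i` gives `φ(x)^2 = (1 + p) φ(x^5)^2` (`theta_one_sq_sub`). Hence `u^5 + v^5 = p(p^2 - 2p + 8)`, so
`u^5` and `v^5` are the roots of a known quadratic, whose solution is the formula for `s(p)`. -/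

/-- The infinite product `(a; q)_∞ = ∏_{k ≥ 0} (1 - a q^k)` over `ℝ` or `ℂ`. -/
def poch {K : Type*} [RCLike K] (a q : K) : K := ∏' k : ℕ, (1 - a * q ^ k)

/-- The two-variable theta series `∑_{n ∈ ℤ} q^(n²) z^n` over `ℝ` or `ℂ`. -/
def theta {K : Type*} [RCLike K] (q z : K) : K := ∑' n : ℤ, q ^ (n ^ 2) * z ^ n

/-! ### Infinite products `(a; q)_∞` -/

section Products

variable {K : Type*} [RCLike K]

lemma summable_norm_mul_pow (a : K) {q : K} (hq : ‖q‖ < 1) :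
    Summable fun k : ℕ => ‖-(a * q ^ k)‖ := by
  simpa [norm_mul, norm_pow] using
    (summable_geometric_of_lt_one (norm_nonneg q) hq).mul_left ‖a‖

lemma multipliable_poch (a : K) {q : K} (hq : ‖q‖ < 1) :
    Multipliable fun k : ℕ => 1 - a * q ^ k := by
  simpa [sub_eq_add_neg] using multipliable_one_add_of_summable (summable_norm_mul_pow a hq)

lemma tendsto_poch (a : K) {q : K} (hq : ‖q‖ < 1) :
    Tendsto (fun N : ℕ => ∏ k ∈ Finset.range N, (1 - a * q ^ k)) atTop (𝓝 (poch a q)) :=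
  (multipliable_poch a hq).hasProd.tendsto_prod_nat

lemma one_sub_mul_pow_ne_zero {a q : K} (ha : ‖a‖ < 1) (hq : ‖q‖ < 1) (k : ℕ) :
    1 - a * q ^ k ≠ 0 := by
  intro h
  have h1 : a * q ^ k = 1 := (sub_eq_zero.mp h).symm
  have h2 : ‖a‖ * ‖q‖ ^ k = 1 := by rw [← norm_pow, ← norm_mul, h1, norm_one]
  have h3 : ‖q‖ ^ k ≤ 1 := pow_le_one₀ (norm_nonneg q) hq.le
  nlinarith [norm_nonneg a]

lemma poch_ne_zero {a q : K} (ha : ‖a‖ < 1) (hq : ‖q‖ < 1) : poch a q ≠ 0 := by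
  have := tprod_one_add_ne_zero_of_summable (f := fun k : ℕ => -(a * q ^ k))
    (fun k => by simpa [sub_eq_add_neg] using one_sub_mul_pow_ne_zero ha hq k)
    (summable_norm_mul_pow a hq)
  simpa [poch, sub_eq_add_neg] using this

lemma norm_pow_lt_one {q : K} (hq : ‖q‖ < 1) {m : ℕ} (hm : m ≠ 0) : ‖q ^ m‖ < 1 := by
  rw [norm_pow]
  exact pow_lt_one₀ (norm_nonneg q) hq hm

lemma poch_mul_poch_neg (a : K) {q : K} (hq : ‖q‖ < 1) :
    poch a q * poch (-a) q = poch (a ^ 2) (q ^ 2) := by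
  refine tendsto_nhds_unique ((tendsto_poch a hq).mul (tendsto_poch (-a) hq)) ?_
  refine (tendsto_poch (a ^ 2) (norm_pow_lt_one hq two_ne_zero)).congr fun N => ?_
  rw [← Finset.prod_mul_distrib]
  exact Finset.prod_congr rfl fun k _ => by ring

lemma poch_eq_mul_poch (a : K) {q : K} (hq : ‖q‖ < 1) :
    poch a q = (1 - a) * poch (a * q) q := by
  refine tendsto_nhds_unique ((tendsto_poch a hq).comp (tendsto_add_atTop_nat 1)) ?_
  refine ((tendsto_poch (a * q) hq).const_mul (1 - a)).congr fun N => ?_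
  simp only [Function.comp, Finset.prod_range_succ']
  rw [mul_comm]
  congr 1
  · exact Finset.prod_congr rfl fun k _ => by ring
  · ring

lemma prod_range_mul_eq (f : ℕ → K) (m N : ℕ) :
    ∏ k ∈ Finset.range (m * N), f k =
      ∏ r ∈ Finset.range m, ∏ k ∈ Finset.range N, f (m * k + r) := by
  rw [Finset.prod_comm]
  induction N with
  | zero => simp
  | succ N ih => rw [mul_add, mul_one, Finset.prod_range_add, ih, Finset.prod_range_succ]

/-- Splitting `(a; q)_∞` according to the residue of the index modulo `m`. -/
lemma poch_eq_prod_poch (a : K) {q : K} (hq : ‖q‖ < 1) {m : ℕ} (hm : m ≠ 0) :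
    poch a q = ∏ r ∈ Finset.range m, poch (a * q ^ r) (q ^ m) := by
  have h1 : Tendsto (fun N : ℕ => m * N) atTop atTop :=
    tendsto_id.const_mul_atTop' (Nat.pos_of_ne_zero hm)
  refine tendsto_nhds_unique ((tendsto_poch a hq).comp h1) ?_
  refine (tendsto_finsetProd _ fun r _ =>
    tendsto_poch (a * q ^ r) (norm_pow_lt_one hq hm)).congr fun N => ?_
  simp only [Function.comp]
  rw [prod_range_mul_eq]
  refine Finset.prod_congr rfl fun r _ => Finset.prod_congr rfl fun k _ => ?_
  ring

end Products

/-! ### Jacobi's triple product -/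

section TripleProduct

variable {K : Type*} [RCLike K]

lemma summable_norm_theta {q z : K} (hq : ‖q‖ < 1) (hq0 : q ≠ 0) (hz : z ≠ 0) :
    Summable fun n : ℤ => ‖q ^ (n ^ 2) * z ^ n‖ := by
  have hq' : 0 < ‖q‖ := norm_pos_iff.mpr hq0
  have hz' : 0 < ‖z‖ := norm_pos_iff.mpr hz
  have hlog : Real.log ‖q‖ < 0 := Real.log_neg hq' hq
  -- Purely imaginary parameters chosen so that the Jacobi terms have the same norms as the terms
  -- here.
  have h := (summable_jacobiTheta₂_term_iff
    (Complex.I * ((-Real.log ‖z‖ / (2 * Real.pi) : ℝ) : ℂ))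
    (Complex.I * ((-Real.log ‖q‖ / Real.pi : ℝ) : ℂ))).mpr (by
      rw [Complex.I_mul_im, Complex.ofReal_re]
      have := Real.pi_pos
      apply div_pos <;> linarith)
  refine h.norm.congr fun n => ?_
  rw [norm_jacobiTheta₂_term, Complex.I_mul_im, Complex.ofReal_re, Complex.I_mul_im,
    Complex.ofReal_re, norm_mul, norm_zpow, norm_zpow, ← Real.rpow_intCast, ← Real.rpow_intCast,
    Real.rpow_def_of_pos hq', Real.rpow_def_of_pos hz', ← Real.exp_add]
  congr 1
  push_cast
  field_simp
  ring

lemma summable_theta {q z : K} (hq : ‖q‖ < 1) (hq0 : q ≠ 0) (hz : z ≠ 0) :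
    Summable fun n : ℤ => q ^ (n ^ 2) * z ^ n :=
  (summable_norm_theta hq hq0 hz).of_norm

/-- The finite product `(q; q)_m = ∏_{1 ≤ k ≤ m} (1 - q^k)`. -/
def pochFin (q : K) (m : ℕ) : K := ∏ k ∈ Finset.range m, (1 - q * q ^ k)

/-- The reciprocal of `(q; q)_m`, with value `0` at negative `m`. -/
def pochFinInv (q : K) (m : ℤ) : K := if m < 0 then 0 else (pochFin q m.toNat)⁻¹

lemma pochFin_ne_zero {q : K} (hq : ‖q‖ < 1) (m : ℕ) : pochFin q m ≠ 0 :=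
  Finset.prod_ne_zero_iff.mpr fun k _ => one_sub_mul_pow_ne_zero hq hq k

lemma pochFin_succ (q : K) (m : ℕ) : pochFin q (m + 1) = pochFin q m * (1 - q ^ (m + 1)) := by
  rw [pochFin, Finset.prod_range_succ, ← pochFin, pow_succ']

/-- The value `0` at negative arguments makes the recursion hold on all of `ℤ`: at `m = 0` the
factor `1 - q^0` vanishes. -/
lemma pochFinInv_sub_one {q : K} (hq : ‖q‖ < 1) (m : ℤ) :
    pochFinInv q (m - 1) = (1 - q ^ m) * pochFinInv q m := by
  rcases lt_trichotomy m 0 with h | h | h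
  · simp [pochFinInv, h, show m - 1 < 0 by lia]
  · subst h; simp [pochFinInv]
  · obtain ⟨k, rfl⟩ : ∃ k : ℕ, m = k + 1 := ⟨(m - 1).toNat, by lia⟩
    have h1 := pochFin_ne_zero hq k
    have h2 := pochFin_ne_zero hq (k + 1)
    rw [pochFinInv, pochFinInv, if_neg (by lia), if_neg (by lia),
      show ((k : ℤ) + 1 - 1).toNat = k by lia, show ((k : ℤ) + 1).toNat = k + 1 by lia]
    rw [pochFin_succ] at h2 ⊢
    have h3 := right_ne_zero_of_mul h2
    rw [show (q ^ ((k : ℤ) + 1)) = q ^ (k + 1) by exact_mod_cast zpow_natCast q (k + 1)]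
    field_simp

/-- The coefficients in the finite form of the triple product identity. -/
def tripleCoeff (q : K) (A B : ℕ) (n : ℤ) : K :=
  pochFin (q ^ 2) (A + B) * pochFinInv (q ^ 2) (A - n) * pochFinInv (q ^ 2) (B + n)

/-- The `q`-Pascal rule with base `r = q^2`, from `1 - r^(A+B+1) = (1 - r^(A+1-n)) + r^(A+1-n) (1 -
r^(B+n))`. -/
lemma tripleCoeff_succ_left {q : K} (hq : ‖q‖ < 1) (hq0 : q ≠ 0) (A B : ℕ) (n : ℤ) :
    tripleCoeff q (A + 1) B n =
      tripleCoeff q A B n + (q ^ 2) ^ ((A : ℤ) + 1 - n) * tripleCoeff q A B (n - 1) := by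
  have hq2 : ‖q ^ 2‖ < 1 := norm_pow_lt_one hq two_ne_zero
  have hp : q ^ 2 ≠ 0 := pow_ne_zero 2 hq0
  have h1 := pochFinInv_sub_one hq2 ((A : ℤ) + 1 - n)
  have h2 := pochFinInv_sub_one hq2 ((B : ℤ) + n)
  rw [show (A : ℤ) + 1 - n - 1 = A - n by ring] at h1
  rw [show (B : ℤ) + n - 1 = B + (n - 1) by ring] at h2
  have h3 : (q ^ 2) ^ (A + B + 1) = (q ^ 2) ^ ((A : ℤ) + 1 - n) * (q ^ 2) ^ ((B : ℤ) + n) := by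
    rw [← zpow_add₀ hp, ← zpow_natCast (q ^ 2) (A + B + 1)]
    congr 1
    push_cast
    ring
  simp only [tripleCoeff]
  rw [show A + 1 + B = A + B + 1 by ring, pochFin_succ, h1, h2, h3,
    show (A : ℤ) - (n - 1) = A + 1 - n by ring]
  push_cast
  ring

lemma tripleCoeff_swap (q : K) (A B : ℕ) (n : ℤ) :
    tripleCoeff q B A (-n) = tripleCoeff q A B n := by
  simp only [tripleCoeff]
  rw [add_comm B A, sub_neg_eq_add, ← sub_eq_add_neg]
  ring

/-- One-sided induction step for the finite triple product. -/
lemma hasSum_tripleCoeff_succ {q z : K} (hq : ‖q‖ < 1) (hq0 : q ≠ 0) (hz : z ≠ 0) {A B : ℕ}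
    {S : K} (h : HasSum (fun n : ℤ => tripleCoeff q A B n * (q ^ (n ^ 2) * z ^ n)) S) :
    HasSum (fun n : ℤ => tripleCoeff q (A + 1) B n * (q ^ (n ^ 2) * z ^ n))
      (S * (1 + z * q ^ (2 * A + 1))) := by
  have h1 := h.mul_right (z * q ^ (2 * A + 1))
  rw [← (Equiv.subRight (1 : ℤ)).hasSum_iff] at h1
  have h2 := h.add h1
  rw [mul_add, mul_one]
  refine h2.congr_fun fun n => ?_
  have e1 : (q ^ 2) ^ ((A : ℤ) + 1 - n) * q ^ (n ^ 2) = q ^ ((n - 1) ^ 2) * q ^ (2 * A + 1) := by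
    rw [← zpow_natCast q 2, ← zpow_mul, ← zpow_natCast q (2 * A + 1), ← zpow_add₀ hq0,
      ← zpow_add₀ hq0]
    congr 1
    push_cast
    ring
  have e2 : z ^ n = z ^ (n - 1) * z := by rw [← zpow_add_one₀ hz, sub_add_cancel]
  simp only [Function.comp, Equiv.subRight_apply]
  rw [tripleCoeff_succ_left hq hq0, add_mul]
  congr 1
  linear_combination (tripleCoeff q A B (n - 1) * z ^ n) * e1 +
    (tripleCoeff q A B (n - 1) * q ^ ((n - 1) ^ 2) * q ^ (2 * A + 1)) * e2

/-- The reflection `n ↦ -n` lets the step that raises `A` also raise `B`, with `z⁻¹` in place of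
`z`. -/
lemma hasSum_tripleCoeff_swap {q z S : K} {A B : ℕ}
    (h : HasSum (fun n : ℤ => tripleCoeff q A B n * (q ^ (n ^ 2) * z ^ n)) S) :
    HasSum (fun n : ℤ => tripleCoeff q B A n * (q ^ (n ^ 2) * z⁻¹ ^ n)) S := by
  rw [← (Equiv.neg ℤ).hasSum_iff] at h
  refine h.congr_fun fun n => ?_
  simp only [Function.comp, Equiv.neg_apply, neg_sq]
  rw [tripleCoeff_swap, zpow_neg, inv_zpow]

/-- The finite form of Jacobi's triple product identity. -/
lemma hasSum_tripleCoeff {q z : K} (hq : ‖q‖ < 1) (hq0 : q ≠ 0) (hz : z ≠ 0) (N : ℕ) :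
    HasSum (fun n : ℤ => tripleCoeff q N N n * (q ^ (n ^ 2) * z ^ n))
      ((∏ k ∈ Finset.range N, (1 - -(z * q) * (q ^ 2) ^ k)) *
        ∏ k ∈ Finset.range N, (1 - -(z⁻¹ * q) * (q ^ 2) ^ k)) := by
  induction N with
  | zero =>
    have h : ∀ n : ℤ, n ≠ 0 → tripleCoeff q 0 0 n * (q ^ (n ^ 2) * z ^ n) = 0 := by
      intro n hn
      rcases lt_or_gt_of_ne hn with h | h <;> simp [tripleCoeff, pochFinInv, h]
    convert hasSum_single 0 h using 1
    simp [tripleCoeff, pochFinInv, pochFin]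
  | succ N ih =>
    have h1 := hasSum_tripleCoeff_swap (hasSum_tripleCoeff_succ hq hq0 hz ih)
    have h2 := hasSum_tripleCoeff_swap (hasSum_tripleCoeff_succ hq hq0 (inv_ne_zero hz) h1)
    rw [inv_inv] at h2
    convert h2 using 1
    rw [Finset.prod_range_succ, Finset.prod_range_succ]
    ring

lemma tendsto_pochFin {q : K} (hq : ‖q‖ < 1) :
    Tendsto (pochFin q) atTop (𝓝 (poch q q)) :=
  tendsto_poch q hq

lemma exists_norm_pochFin_le {q : K} (hq : ‖q‖ < 1) : ∃ C, ∀ m, ‖pochFin q m‖ ≤ C := by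
  obtain ⟨C, hC⟩ :=
    (Metric.isBounded_range_of_tendsto _ (tendsto_pochFin hq)).exists_norm_le
  exact ⟨C, fun m => hC _ ⟨m, rfl⟩⟩

lemma exists_norm_pochFinInv_le {q : K} (hq : ‖q‖ < 1) : ∃ C, 0 ≤ C ∧ ∀ m, ‖pochFinInv q m‖ ≤ C := by
  obtain ⟨C, hC⟩ := (Metric.isBounded_range_of_tendsto _
    ((tendsto_pochFin hq).inv₀ (poch_ne_zero hq hq))).exists_norm_le
  have h0 : 0 ≤ C := (norm_nonneg _).trans (hC _ ⟨0, rfl⟩)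
  refine ⟨C, h0, fun m => ?_⟩
  rw [pochFinInv]
  split_ifs
  · simpa using h0
  · exact hC _ ⟨m.toNat, rfl⟩

lemma tendsto_pochFinInv {q : K} (hq : ‖q‖ < 1) :
    Tendsto (pochFinInv q) atTop (𝓝 (poch q q)⁻¹) := by
  have h1 := ((tendsto_pochFin hq).inv₀ (poch_ne_zero hq hq)).comp
    (tendsto_atTop_atTop.mpr fun b => ⟨(b : ℤ), fun a ha => by lia⟩ :
      Tendsto Int.toNat atTop atTop)
  refine h1.congr' ?_
  filter_upwards [eventually_ge_atTop 0] with m hm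
  simp [pochFinInv, not_lt.mpr hm]

lemma tendsto_tripleCoeff {q : K} (hq : ‖q‖ < 1) (n : ℤ) :
    Tendsto (fun N : ℕ => tripleCoeff q N N n) atTop (𝓝 (poch (q ^ 2) (q ^ 2))⁻¹) := by
  have hq2 : ‖q ^ 2‖ < 1 := norm_pow_lt_one hq two_ne_zero
  have hne := poch_ne_zero hq2 hq2
  have t1 : Tendsto (fun N : ℕ => N + N) atTop atTop := tendsto_id.atTop_add_atTop tendsto_id
  have t2 : Tendsto (fun N : ℕ => (N : ℤ) - n) atTop atTop :=
    tendsto_atTop_add_const_right _ (-n) tendsto_natCast_atTop_atTop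
  have t3 : Tendsto (fun N : ℕ => (N : ℤ) + n) atTop atTop :=
    tendsto_atTop_add_const_right _ n tendsto_natCast_atTop_atTop
  have h := (((tendsto_pochFin hq2).comp t1).mul ((tendsto_pochFinInv hq2).comp t2)).mul
    ((tendsto_pochFinInv hq2).comp t3)
  rwa [mul_inv_cancel₀ hne, one_mul] at h

/-- Jacobi's triple product identity. -/
theorem theta_eq_poch {q z : K} (hq : ‖q‖ < 1) (hq0 : q ≠ 0) (hz : z ≠ 0) :
    theta q z = poch (q ^ 2) (q ^ 2) * (poch (-(z * q)) (q ^ 2) * poch (-(z⁻¹ * q)) (q ^ 2)) := by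
  have hq2 : ‖q ^ 2‖ < 1 := norm_pow_lt_one hq two_ne_zero
  obtain ⟨C, hC⟩ := exists_norm_pochFin_le hq2
  obtain ⟨D, hD0, hD⟩ := exists_norm_pochFinInv_le hq2
  have hC0 : 0 ≤ C := (norm_nonneg _).trans (hC 0)
  -- The coefficients are bounded uniformly in `N` and `n`, so the absolutely convergent theta
  -- series dominates.
  have hlim := tendsto_tsum_of_dominated_convergence
    (f := fun (N : ℕ) (n : ℤ) => tripleCoeff q N N n * (q ^ (n ^ 2) * z ^ n))
    (g := fun n : ℤ => (poch (q ^ 2) (q ^ 2))⁻¹ * (q ^ (n ^ 2) * z ^ n)) (𝓕 := atTop)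
    ((summable_norm_theta hq hq0 hz).mul_left (C * D * D))
    (fun n => (tendsto_tripleCoeff hq n).mul_const _)
    (Eventually.of_forall fun N n => by
      rw [norm_mul]
      refine mul_le_mul_of_nonneg_right ?_ (norm_nonneg _)
      rw [tripleCoeff, norm_mul, norm_mul]
      gcongr
      exacts [hC _, hD _, hD _])
  rw [tsum_mul_left, ← theta] at hlim
  have h := tendsto_nhds_unique
    (hlim.congr fun N => (hasSum_tripleCoeff hq hq0 hz N).tsum_eq)
    ((tendsto_poch (-(z * q)) hq2).mul (tendsto_poch (-(z⁻¹ * q)) hq2))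
  rw [← h, mul_inv_cancel_left₀ (poch_ne_zero hq2 hq2)]

end TripleProduct

/-! ### Product formulas for theta values -/

section ThetaIdentities

variable {K : Type*} [RCLike K]

lemma theta_inv (q z : K) : theta q z⁻¹ = theta q z := by
  rw [theta, theta, ← (Equiv.neg ℤ).tsum_eq]
  refine tsum_congr fun n => ?_
  simp

lemma theta_shift {q z : K} (hq0 : q ≠ 0) (hz : z ≠ 0) :
    q * z * theta q (z * q ^ 2) = theta q z := by
  rw [theta, theta, ← tsum_mul_left, ← (Equiv.addRight (1 : ℤ)).tsum_eq
    fun n : ℤ => q ^ (n ^ 2) * z ^ n]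
  refine tsum_congr fun n => ?_
  simp only [Equiv.coe_addRight]
  rw [mul_zpow, show (n + 1) ^ 2 = n ^ 2 + 2 * n + 1 by ring, zpow_add₀ hq0, zpow_add₀ hq0,
    zpow_one, zpow_add_one₀ hz, zpow_mul, zpow_ofNat]
  ring

lemma theta_one_eq {q : K} (hq : ‖q‖ < 1) (hq0 : q ≠ 0) :
    theta q 1 = poch (q ^ 2) (q ^ 2) * poch (-q) (q ^ 2) ^ 2 := by
  rw [theta_eq_poch hq hq0 one_ne_zero]
  simp only [inv_one, one_mul]
  ring

lemma poch_self_eq {q : K} (hq : ‖q‖ < 1) :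
    poch q q = poch q (q ^ 2) * poch (q ^ 2) (q ^ 2) := by
  rw [poch_eq_prod_poch q hq two_ne_zero, Finset.prod_range_succ, Finset.prod_range_one]
  congr 2 <;> ring

/-- From `(q; q²)_∞ (-q; q²)_∞ = (q²; q⁴)_∞`, after splitting `(q; q)_∞` and `(q²; q²)_∞` by parity.
-/
lemma poch_neg_mul_poch_self {q : K} (hq : ‖q‖ < 1) :
    poch (-q) (q ^ 2) * (poch q q * poch (q ^ 4) (q ^ 4)) = poch (q ^ 2) (q ^ 2) ^ 2 := by
  have hq2 : ‖q ^ 2‖ < 1 := norm_pow_lt_one hq two_ne_zero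
  have h1 := poch_self_eq hq
  have h2 := poch_self_eq hq2
  have h3 := poch_mul_poch_neg q hq2
  rw [← pow_mul] at h2 h3
  norm_num at h2 h3
  rw [h1]
  linear_combination (poch (q ^ 4) (q ^ 4) * poch (q ^ 2) (q ^ 2)) * h3 -
    poch (q ^ 2) (q ^ 2) * h2

lemma theta_one_mul_poch {q : K} (hq : ‖q‖ < 1) (hq0 : q ≠ 0) :
    theta q 1 * (poch q q ^ 2 * poch (q ^ 4) (q ^ 4) ^ 2) = poch (q ^ 2) (q ^ 2) ^ 5 := by
  have h := poch_neg_mul_poch_self hq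
  rw [theta_one_eq hq hq0]
  linear_combination (poch (q ^ 2) (q ^ 2) * (poch (-q) (q ^ 2) * (poch q q * poch (q ^ 4) (q ^ 4))
    + poch (q ^ 2) (q ^ 2) ^ 2)) * h

lemma theta_neg_one_mul_poch {q : K} (hq : ‖q‖ < 1) (hq0 : q ≠ 0) :
    theta q (-1) * poch (q ^ 2) (q ^ 2) = poch q q ^ 2 := by
  rw [theta_eq_poch hq hq0 (neg_ne_zero.mpr one_ne_zero), poch_self_eq hq]
  simp only [inv_neg, inv_one, neg_mul, one_mul, neg_neg]
  ring

lemma theta_self_mul_poch {q : K} (hq : ‖q‖ < 1) (hq0 : q ≠ 0) :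
    theta q q * poch (q ^ 2) (q ^ 2) = 2 * poch (q ^ 4) (q ^ 4) ^ 2 := by
  have hq2 : ‖q ^ 2‖ < 1 := norm_pow_lt_one hq two_ne_zero
  have h1 := poch_mul_poch_neg (q ^ 2) hq2
  rw [← pow_mul] at h1
  norm_num at h1
  rw [theta_eq_poch hq hq0 hq0, inv_mul_cancel₀ hq0, poch_eq_mul_poch (-1) hq2, ← h1]
  rw [show -1 * q ^ 2 = -(q ^ 2) by ring, show q * q = q ^ 2 by ring]
  ring

/-- Inversion exchanges the two theta values on the left, up to elementary factors; this drives
`chiNorm_inv`. -/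
lemma poch_neg_pow_six_mul {q : K} (hq : ‖q‖ < 1) (hq0 : q ≠ 0) :
    poch (-q) (q ^ 2) ^ 6 * (theta q q * theta q (-1)) = 2 * theta q 1 ^ 2 := by
  have hq2 : ‖q ^ 2‖ < 1 := norm_pow_lt_one hq two_ne_zero
  have hne := poch_ne_zero hq2 hq2
  have h1 := poch_neg_mul_poch_self hq
  have h2 := theta_self_mul_poch hq hq0
  have h3 := theta_neg_one_mul_poch hq hq0
  have h4 := theta_one_eq hq hq0
  have h5 : theta q q * theta q (-1) * poch (q ^ 2) (q ^ 2) ^ 2 =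
      2 * (poch q q * poch (q ^ 4) (q ^ 4)) ^ 2 := by
    linear_combination (theta q (-1) * poch (q ^ 2) (q ^ 2)) * h2 +
      2 * poch (q ^ 4) (q ^ 4) ^ 2 * h3
  apply mul_right_cancel₀ (pow_ne_zero 2 hne)
  rw [h4]
  generalize poch (q ^ 2) (q ^ 2) = E at *
  generalize poch (-q) (q ^ 2) = X at *
  generalize poch q q * poch (q ^ 4) (q ^ 4) = Y at *
  linear_combination X ^ 6 * h5 + 2 * X ^ 4 * (X * Y + E ^ 2) * h1

/-- `∑ x^(5n²+4n) · ∑ x^(5n²+2n)` as a product. -/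
lemma theta_mul_theta_mul_poch {x : K} (hx : ‖x‖ < 1) (hx0 : x ≠ 0) :
    theta (x ^ 5) (x ^ 4) * theta (x ^ 5) (x ^ 2) * poch (-x ^ 5) (x ^ 10) ^ 5 =
      theta (x ^ 5) 1 ^ 2 * poch (-x) (x ^ 2) := by
  have hx2 : ‖x ^ 2‖ < 1 := norm_pow_lt_one hx two_ne_zero
  have hx5 : ‖x ^ 5‖ < 1 := norm_pow_lt_one hx (by norm_num)
  have hx50 : x ^ 5 ≠ 0 := pow_ne_zero 5 hx0
  -- Of the five residue factors of `χ(x)`, the middle one is `χ(x^5)`; the other four belong to the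
  -- two theta products.
  have h := poch_eq_prod_poch (-x) hx2 (show (5 : ℕ) ≠ 0 by norm_num)
  simp only [Finset.prod_range_succ, Finset.prod_range_zero] at h
  rw [theta_eq_poch hx5 hx50 (pow_ne_zero 4 hx0), theta_eq_poch hx5 hx50 (pow_ne_zero 2 hx0),
    theta_one_eq hx5 hx50, h]
  rw [show -x * (x ^ 2) ^ 0 = -x by ring, show -x * (x ^ 2) ^ 1 = -x ^ 3 by ring,
    show -x * (x ^ 2) ^ 2 = -x ^ 5 by ring, show -x * (x ^ 2) ^ 3 = -x ^ 7 by ring,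
    show -x * (x ^ 2) ^ 4 = -x ^ 9 by ring, show (x ^ 2) ^ 5 = x ^ 10 by ring,
    show (x ^ 5) ^ 2 = x ^ 10 by ring, show -(x ^ 4 * x ^ 5) = -x ^ 9 by ring,
    show -(x ^ 2 * x ^ 5) = -x ^ 7 by ring, show -((x ^ 4)⁻¹ * x ^ 5) = -x by field_simp,
    show -((x ^ 2)⁻¹ * x ^ 5) = -x ^ 3 by field_simp]
  ring

end ThetaIdentities

/-! ### Products over the fifth roots of unity -/

section FifthRoots

variable {K : Type*} [RCLike K]

/-- The relation satisfied by a primitive fifth root of unity. -/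
def IsFifth (ζ : K) : Prop := 1 + ζ + ζ ^ 2 + ζ ^ 3 + ζ ^ 4 = 0

lemma IsFifth.pow_five {ζ : K} (h : IsFifth ζ) : ζ ^ 5 = 1 := by
  unfold IsFifth at h
  linear_combination (ζ - 1) * h

lemma IsFifth.norm_eq_one {ζ : K} (h : IsFifth ζ) : ‖ζ‖ = 1 := by
  have h1 : ‖ζ‖ ^ 5 = 1 := by rw [← norm_pow, h.pow_five, norm_one]
  exact (pow_eq_one_iff_of_nonneg (norm_nonneg ζ) (by norm_num)).mp h1

lemma IsFifth.sq {ζ : K} (h : IsFifth ζ) : IsFifth (ζ ^ 2) := by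
  have h5 := h.pow_five
  unfold IsFifth at *
  linear_combination h + (ζ + ζ ^ 3) * h5

lemma IsFifth.cube {ζ : K} (h : IsFifth ζ) : IsFifth (ζ ^ 3) := by
  have h5 := h.pow_five
  unfold IsFifth at *
  linear_combination h + (ζ + ζ ^ 4 + ζ ^ 2 * (ζ ^ 5 + 1)) * h5

lemma prod_one_sub_fifth {ζ : K} (h : IsFifth ζ) (y : K) :
    ∏ j ∈ Finset.range 5, (1 - ζ ^ j * y) = 1 - y ^ 5 := by
  have h5 := h.pow_five
  unfold IsFifth at h
  simp only [Finset.prod_range_succ, Finset.prod_range_zero]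
  have h14 : (1 - ζ * y) * (1 - ζ ^ 4 * y) = 1 - (ζ + ζ ^ 4) * y + y ^ 2 := by
    linear_combination y ^ 2 * h5
  have h23 : (1 - ζ ^ 2 * y) * (1 - ζ ^ 3 * y) = 1 + (1 + ζ + ζ ^ 4) * y + y ^ 2 := by
    linear_combination y ^ 2 * h5 - y * h
  have hα : (ζ + ζ ^ 4) ^ 2 = 1 - (ζ + ζ ^ 4) := by
    linear_combination h + (2 + ζ ^ 3) * h5
  linear_combination (1 - y) * (1 - ζ ^ 2 * y) * (1 - ζ ^ 3 * y) * h14 +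
    (1 - y) * (1 - (ζ + ζ ^ 4) * y + y ^ 2) * h23 - (1 - y) * y ^ 2 * hα

/-- The product is invariant under `(u, v) ↦ (ζu, ζ⁻¹v)`, so only `u^5`, `v^5` and `uv` survive. The
proof pairs conjugate factors and uses `α^2 + α = 1` for `α = ζ + ζ^4`. -/
lemma prod_one_add_add_fifth {ζ : K} (h : IsFifth ζ) (u v : K) :
    ∏ j ∈ Finset.range 5, (1 + ζ ^ j * u + ζ ^ (4 * j) * v) =
      1 + u ^ 5 + v ^ 5 - 5 * (u * v) + 5 * (u * v) ^ 2 := by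
  have h5 := h.pow_five
  have hpow (k r : ℕ) : ζ ^ (5 * k + r) = ζ ^ r := by rw [pow_add, pow_mul, h5, one_pow, one_mul]
  have h8 := hpow 1 3
  have h12 := hpow 2 2
  have h16 := hpow 3 1
  unfold IsFifth at h
  simp only [Finset.prod_range_succ, Finset.prod_range_zero]
  norm_num at h8 h12 h16 ⊢
  rw [h8, h12, h16]
  obtain ⟨α, hα⟩ : ∃ α, α = ζ + ζ ^ 4 := ⟨_, rfl⟩
  have h14 : (1 + ζ * u + ζ ^ 4 * v) * (1 + ζ ^ 4 * u + ζ * v) =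
      1 + α * (u + v) + u ^ 2 + v ^ 2 - (1 + α) * (u * v) := by
    rw [hα]
    linear_combination (u ^ 2 + v ^ 2 + ζ ^ 3 * (u * v)) * h5 + u * v * h
  have h23 : (1 + ζ ^ 2 * u + ζ ^ 3 * v) * (1 + ζ ^ 3 * u + ζ ^ 2 * v) =
      1 - (1 + α) * (u + v) + u ^ 2 + v ^ 2 + α * (u * v) := by
    rw [hα]
    linear_combination (u ^ 2 + v ^ 2 + ζ * (u * v)) * h5 + (u + v) * h
  have hα2 : α ^ 2 = 1 - α := by
    rw [hα]
    linear_combination h + (2 + ζ ^ 3) * h5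
  linear_combination (1 + u + v) * (1 + ζ ^ 2 * u + ζ ^ 3 * v) * (1 + ζ ^ 3 * u + ζ ^ 2 * v) * h14 +
    (1 + u + v) * (1 + α * (u + v) + u ^ 2 + v ^ 2 - (1 + α) * (u * v)) * h23 -
    (1 + u + v) * (u + v - u * v) ^ 2 * hα2

lemma prod_poch_fifth {ζ : K} (h : IsFifth ζ) (a : K) {q : K} (hq : ‖q‖ < 1) :
    ∏ j ∈ Finset.range 5, poch (ζ ^ j * a) q = poch (a ^ 5) (q ^ 5) := by
  refine tendsto_nhds_unique (tendsto_finsetProd _ fun j _ => tendsto_poch (ζ ^ j * a) hq) ?_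
  refine (tendsto_poch (a ^ 5) (norm_pow_lt_one hq (by norm_num))).congr fun N => ?_
  rw [Finset.prod_comm]
  refine Finset.prod_congr rfl fun k _ => ?_
  rw [← pow_mul, mul_comm 5 k, pow_mul, ← mul_pow, ← prod_one_sub_fifth h]
  exact Finset.prod_congr rfl fun j _ => by ring

/-- The product of `(q; q)_∞` over the points `ζ^j Q`. -/
lemma prod_poch_self_fifth {ζ : K} (h : IsFifth ζ) {Q : K} (hQ : ‖Q‖ < 1) :
    (∏ j ∈ Finset.range 5, poch (ζ ^ j * Q) (ζ ^ j * Q)) * poch ((Q ^ 5) ^ 5) ((Q ^ 5) ^ 5) =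
      poch (Q ^ 5) (Q ^ 5) ^ 6 := by
  have h5 := h.pow_five
  have hζ := h.norm_eq_one
  have hx : ‖Q ^ 5‖ < 1 := norm_pow_lt_one hQ (by norm_num)
  have hsplit (j : ℕ) : poch (ζ ^ j * Q) (ζ ^ j * Q) =
      ∏ r ∈ Finset.range 5, poch ((ζ ^ (r + 1)) ^ j * Q ^ (r + 1)) (Q ^ 5) := by
    have hn : ‖ζ ^ j * Q‖ < 1 := by simpa [hζ] using hQ
    rw [poch_eq_prod_poch _ hn (show (5 : ℕ) ≠ 0 by norm_num)]
    refine Finset.prod_congr rfl fun r _ => ?_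
    congr 1
    · ring
    · rw [mul_pow, ← pow_mul, mul_comm j 5, pow_mul, h5, one_pow, one_mul]
  -- For `r < 4`, `ζ^(r+1)` is again primitive and the product over `j` collapses; for `r = 4` it is
  -- `1`, giving a fifth power.
  rw [Finset.prod_congr rfl fun j _ => hsplit j, Finset.prod_comm, Finset.prod_range_succ]
  have hx' := poch_eq_prod_poch (Q ^ 5) hx (show (5 : ℕ) ≠ 0 by norm_num)
  rw [Finset.prod_range_succ] at hx'
  have hrest : ∏ r ∈ Finset.range 4, ∏ j ∈ Finset.range 5,
      poch ((ζ ^ (r + 1)) ^ j * Q ^ (r + 1)) (Q ^ 5) =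
      ∏ r ∈ Finset.range 4, poch (Q ^ 5 * (Q ^ 5) ^ r) ((Q ^ 5) ^ 5) := by
    refine Finset.prod_congr rfl fun r hr => ?_
    have hr' : IsFifth (ζ ^ (r + 1)) := by
      have : r < 4 := Finset.mem_range.mp hr
      interval_cases r
      · simpa using h
      · exact h.sq
      · exact h.cube
      · have := h.sq.sq
        rwa [← pow_mul] at this
    rw [prod_poch_fifth hr' _ hx]
    congr 1
    ring
  have hlast : ∏ j ∈ Finset.range 5, poch ((ζ ^ (4 + 1)) ^ j * Q ^ (4 + 1)) (Q ^ 5) =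
      poch (Q ^ 5) (Q ^ 5) ^ 5 := by
    simp [h5]
  rw [hrest, hlast, show Q ^ 5 * (Q ^ 5) ^ 4 = (Q ^ 5) ^ 5 by ring] at *
  linear_combination (-poch (Q ^ 5) (Q ^ 5) ^ 5) * hx'

/-- With `f_m = (q^m; q^m)_∞`, `φ(q) = f_2^5 / (f_1^2 f_4^2)`; `prod_poch_self_fifth` applies to
each `f_m`, with root `ζ^m` and point `Q^m`. -/
lemma prod_theta_one_fifth {ζ : K} (h : IsFifth ζ) {Q : K} (hQ : ‖Q‖ < 1) (hQ0 : Q ≠ 0) :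
    (∏ j ∈ Finset.range 5, theta (ζ ^ j * Q) 1) * theta ((Q ^ 5) ^ 5) 1 =
      theta (Q ^ 5) 1 ^ 6 := by
  have h5 := h.pow_five
  have hζ0 : ζ ≠ 0 := by rintro rfl; norm_num at h5
  have hζ := h.norm_eq_one
  have hx : ‖Q ^ 5‖ < 1 := norm_pow_lt_one hQ (by norm_num)
  have hx0 : Q ^ 5 ≠ 0 := pow_ne_zero 5 hQ0
  have hX : ‖(Q ^ 5) ^ 5‖ < 1 := norm_pow_lt_one hx (by norm_num)
  have hX0 : (Q ^ 5) ^ 5 ≠ 0 := pow_ne_zero 5 hx0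
  have hn (j : ℕ) : ‖ζ ^ j * Q‖ < 1 := by simpa [hζ] using hQ
  have hprod := Finset.prod_congr (rfl : Finset.range 5 = Finset.range 5) fun j _ =>
    theta_one_mul_poch (hn j) (mul_ne_zero (pow_ne_zero j hζ0) hQ0)
  simp only [Finset.prod_mul_distrib, Finset.prod_pow] at hprod
  have e1 := prod_poch_self_fifth h hQ
  have e2 := prod_poch_self_fifth h.sq (norm_pow_lt_one hQ two_ne_zero)
  have e4 := prod_poch_self_fifth h.sq.sq (norm_pow_lt_one hQ four_ne_zero)
  have hr2 : ∏ j ∈ Finset.range 5, poch ((ζ ^ 2) ^ j * Q ^ 2) ((ζ ^ 2) ^ j * Q ^ 2) =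
      ∏ j ∈ Finset.range 5, poch ((ζ ^ j * Q) ^ 2) ((ζ ^ j * Q) ^ 2) :=
    Finset.prod_congr rfl fun j _ => by congr 1 <;> ring
  have hr4 : ∏ j ∈ Finset.range 5, poch (((ζ ^ 2) ^ 2) ^ j * Q ^ 4) (((ζ ^ 2) ^ 2) ^ j * Q ^ 4) =
      ∏ j ∈ Finset.range 5, poch ((ζ ^ j * Q) ^ 4) ((ζ ^ j * Q) ^ 4) :=
    Finset.prod_congr rfl fun j _ => by congr 1 <;> ring
  have c (a b : ℕ) (y : K) : (y ^ a) ^ b = (y ^ b) ^ a := by rw [← pow_mul, ← pow_mul, mul_comm]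
  rw [hr2, c 2 5, c 2 5] at e2
  rw [hr4, c 4 5, c 4 5] at e4
  have tx := theta_one_mul_poch hx hx0
  have tX := theta_one_mul_poch hX hX0
  have hne {y : K} (hy : ‖y‖ < 1) {m : ℕ} (hm : m ≠ 0) : poch (y ^ m) (y ^ m) ≠ 0 :=
    poch_ne_zero (norm_pow_lt_one hy hm) (norm_pow_lt_one hy hm)
  have n1 := poch_ne_zero hx hx
  have n2 := hne hx two_ne_zero
  have n4 := hne hx four_ne_zero
  have m1 := poch_ne_zero hX hX
  have m2 := hne hX two_ne_zero
  have m4 := hne hX four_ne_zero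
  clear hr2 hr4
  generalize poch (Q ^ 5) (Q ^ 5) = B1 at *
  generalize poch ((Q ^ 5) ^ 2) ((Q ^ 5) ^ 2) = B2 at *
  generalize poch ((Q ^ 5) ^ 4) ((Q ^ 5) ^ 4) = B4 at *
  generalize poch ((Q ^ 5) ^ 5) ((Q ^ 5) ^ 5) = C1 at *
  generalize poch (((Q ^ 5) ^ 5) ^ 2) (((Q ^ 5) ^ 5) ^ 2) = C2 at *
  generalize poch (((Q ^ 5) ^ 5) ^ 4) (((Q ^ 5) ^ 5) ^ 4) = C4 at *
  generalize (∏ j ∈ Finset.range 5, poch (ζ ^ j * Q) (ζ ^ j * Q)) = A1 at *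
  generalize (∏ j ∈ Finset.range 5, poch ((ζ ^ j * Q) ^ 2) ((ζ ^ j * Q) ^ 2)) = A2 at *
  generalize (∏ j ∈ Finset.range 5, poch ((ζ ^ j * Q) ^ 4) ((ζ ^ j * Q) ^ 4)) = A4 at *
  generalize (∏ j ∈ Finset.range 5, theta (ζ ^ j * Q) 1) = T at *
  rw [← eq_div_iff m1] at e1
  rw [← eq_div_iff m2] at e2
  rw [← eq_div_iff m4] at e4
  rw [← eq_div_iff (by positivity)] at tx tX
  rw [e1, e2, e4] at hprod
  rw [← eq_div_iff (by positivity)] at hprod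
  rw [hprod, tx, tX]
  field_simp

end FifthRoots

/-! ### Dissections of `φ` and `φ²` modulo 5 -/

section Dissection

variable {K : Type*} [RCLike K]

lemma tsum_eq_sum_tsum_of_equiv {ι α β : Type*} [Fintype ι] (e : ι × α ≃ β) {f : β → K}
    (hf : Summable f) : ∑' b, f b = ∑ i, ∑' a, f (e (i, a)) := by
  have h : Summable fun p => f (e p) := e.summable_iff.mpr hf
  rw [← e.tsum_eq f, h.tsum_prod, tsum_fintype]

lemma tsum_int_eq_sum_tsum_five {f : ℤ → K} (hf : Summable f) :
    ∑' n, f n = ∑ r : Fin 5, ∑' k : ℤ, f (5 * k + (r : ℕ)) := by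
  rw [tsum_eq_sum_tsum_of_equiv ((Equiv.prodComm (Fin 5) ℤ).trans (Int.divModEquiv 5).symm) hf]
  simp [mul_comm]

lemma theta_mul_theta {q z w : K} (hq : ‖q‖ < 1) (hq0 : q ≠ 0) (hz : z ≠ 0) (hw : w ≠ 0) :
    theta q z * theta q w =
      ∑' p : ℤ × ℤ, (q ^ (p.1 ^ 2) * z ^ p.1) * (q ^ (p.2 ^ 2) * w ^ p.2) := by
  rw [theta, theta]
  exact tsum_mul_tsum_of_summable_norm (summable_norm_theta hq hq0 hz) (summable_norm_theta hq hq0 hw)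

lemma summable_theta_mul_theta {q z w : K} (hq : ‖q‖ < 1) (hq0 : q ≠ 0) (hz : z ≠ 0)
    (hw : w ≠ 0) :
    Summable fun p : ℤ × ℤ => (q ^ (p.1 ^ 2) * z ^ p.1) * (q ^ (p.2 ^ 2) * w ^ p.2) := by
  have h := summable_mul_of_summable_norm (f := fun n : ℤ => q ^ (n ^ 2) * z ^ n)
    (g := fun n : ℤ => q ^ (n ^ 2) * w ^ n) (summable_norm_theta hq hq0 hz)
    (summable_norm_theta hq hq0 hw)
  exact h

/-- The decomposition of `ℤ[i]` into the five cosets `r + (2 + i) ℤ[i]`, `0 ≤ r < 5`. -/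
def gaussCosetEquiv : Fin 5 × ℤ × ℤ ≃ ℤ × ℤ where
  toFun p := (2 * p.2.1 + p.2.2 + ((p.1 : ℕ) : ℤ), p.2.1 - 2 * p.2.2)
  -- On the image of `(r, a, b)`, `p.1 - 2 * p.2 = 5b + r`.
  invFun p := (⟨((p.1 - 2 * p.2) % 5).toNat, by omega⟩,
    p.2 + 2 * ((p.1 - 2 * p.2) / 5), (p.1 - 2 * p.2) / 5)
  left_inv := by
    rintro ⟨⟨r, hr⟩, a, b⟩
    simp only [Prod.mk.injEq, Fin.mk.injEq]
    omega
  right_inv := by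
    rintro ⟨a, b⟩
    simp only [Prod.mk.injEq]
    omega

lemma gaussCosetEquiv_apply (r : Fin 5) (p : ℤ × ℤ) :
    gaussCosetEquiv (r, p) = (2 * p.1 + p.2 + ((r : ℕ) : ℤ), p.1 - 2 * p.2) := rfl

/-- The sum of squares is `5a² + 5b² + 4ra + 2rb + r²`: no cross term, so the double sum factors. -/
lemma tsum_gaussCoset {x : K} (hx : ‖x‖ < 1) (hx0 : x ≠ 0) (r : ℕ) :
    ∑' p : ℤ × ℤ, x ^ ((2 * p.1 + p.2 + (r : ℤ)) ^ 2) * x ^ ((p.1 - 2 * p.2) ^ 2) =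
      x ^ (r ^ 2) * (theta (x ^ 5) (x ^ (4 * r)) * theta (x ^ 5) (x ^ (2 * r))) := by
  rw [theta_mul_theta (norm_pow_lt_one hx (by norm_num)) (pow_ne_zero 5 hx0)
    (pow_ne_zero _ hx0) (pow_ne_zero _ hx0), ← tsum_mul_left]
  refine tsum_congr fun p => ?_
  simp only [← zpow_natCast x, ← zpow_mul, ← zpow_add₀ hx0]
  congr 1
  push_cast
  ring

lemma theta_one_sq_eq_sum {x : K} (hx : ‖x‖ < 1) (hx0 : x ≠ 0) :
    theta x 1 ^ 2 = ∑ r : Fin 5, x ^ ((r : ℕ) ^ 2) *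
      (theta (x ^ 5) (x ^ (4 * (r : ℕ))) * theta (x ^ 5) (x ^ (2 * (r : ℕ)))) := by
  have h1 := theta_mul_theta hx hx0 one_ne_zero one_ne_zero
  have h2 := summable_theta_mul_theta hx hx0 one_ne_zero one_ne_zero
  simp only [one_zpow, mul_one] at h1 h2
  rw [pow_two, h1, tsum_eq_sum_tsum_of_equiv gaussCosetEquiv h2]
  refine Finset.sum_congr rfl fun r _ => ?_
  simp only [gaussCosetEquiv_apply]
  exact tsum_gaussCoset hx hx0 r

/-- The five-dissection of the theta series `∑ q^(n²)`. -/
lemma theta_one_dissection {q : K} (hq : ‖q‖ < 1) (hq0 : q ≠ 0) :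
    theta q 1 = theta (q ^ 25) 1 + 2 * (q * theta (q ^ 25) (q ^ 10)) +
      2 * (q ^ 4 * theta (q ^ 25) (q ^ 20)) := by
  have key (r : ℕ) : ∑' k : ℤ, q ^ ((5 * k + (r : ℤ)) ^ 2) * (1 : K) ^ (5 * k + (r : ℤ)) =
      q ^ (r ^ 2) * theta (q ^ 25) (q ^ (10 * r)) := by
    rw [theta, ← tsum_mul_left]
    refine tsum_congr fun k => ?_
    rw [one_zpow, mul_one, ← zpow_natCast q 25, ← zpow_natCast q (10 * r), ← zpow_mul, ← zpow_mul,
      ← zpow_natCast, ← zpow_add₀ hq0, ← zpow_add₀ hq0]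
    congr 1
    push_cast
    ring
  -- Residues 3 and 4 mirror 2 and 1 under `n ↦ -n`, whence the coefficients 2.
  have e3 : q ^ 5 * theta (q ^ 25) (q ^ 30) = theta (q ^ 25) (q ^ 20) := by
    have := theta_shift (q := q ^ 25) (z := (q ^ 20)⁻¹) (by positivity) (by positivity)
    rw [theta_inv] at this
    rw [← this]
    congr 1
    · field_simp
    · congr 1; field_simp
  have e4 : q ^ 15 * theta (q ^ 25) (q ^ 40) = theta (q ^ 25) (q ^ 10) := by
    have := theta_shift (q := q ^ 25) (z := (q ^ 10)⁻¹) (by positivity) (by positivity)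
    rw [theta_inv] at this
    rw [← this]
    congr 1
    · field_simp
    · congr 1; field_simp
  rw [theta, tsum_int_eq_sum_tsum_five (summable_theta hq hq0 one_ne_zero)]
  simp only [key, Fin.sum_univ_five]
  norm_num
  linear_combination q ^ 4 * e3 + q * e4

/-- The relation between the squares of the theta series at `x` and at `x^5`: the sublattice of
multiples of `2 + i` in `ℤ[i]` has five cosets, of which the units permute the nonzero ones. -/
lemma theta_one_sq_sub {x : K} (hx : ‖x‖ < 1) (hx0 : x ≠ 0) :
    theta x 1 ^ 2 = theta (x ^ 5) 1 ^ 2 +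
      4 * x * (theta (x ^ 5) (x ^ 4) * theta (x ^ 5) (x ^ 2)) := by
  have hx50 : x ^ 5 ≠ 0 := pow_ne_zero 5 hx0
  -- Quasi-periodicity, with reflection in `shift` and without it in `shift'`, makes the four terms
  -- `r ≠ 0` equal.
  have shift (m l k : ℕ) (hm : m + l = 10) (hk : k + l = 5) :
      x ^ k * theta (x ^ 5) (x ^ m) = theta (x ^ 5) (x ^ l) := by
    have := theta_shift (q := x ^ 5) (z := (x ^ l)⁻¹) (by positivity) (by positivity)
    rw [theta_inv] at this
    rw [← this]
    have h5 : x ^ 5 = x ^ k * x ^ l := by rw [← pow_add, hk]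
    have h10 : (x ^ 5) ^ 2 = x ^ m * x ^ l := by rw [← pow_add, hm, ← pow_mul]
    congr 1
    · rw [h5]; field_simp
    · rw [h10]; congr 1; field_simp
  have shift' (m l k : ℕ) (hm : m = l + 10) (hk : k = l + 5) :
      x ^ k * theta (x ^ 5) (x ^ m) = theta (x ^ 5) (x ^ l) := by
    rw [← theta_shift hx50 (pow_ne_zero l hx0), hm, hk]
    congr 2 <;> ring
  have s8 := shift 8 2 3 rfl rfl
  have s6 := shift 6 4 1 rfl rfl
  have s12 := shift' 12 2 7 rfl rfl
  have s16 := shift' 16 6 11 rfl rfl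
  rw [theta_one_sq_eq_sum hx hx0]
  simp only [Fin.sum_univ_five]
  norm_num
  simp only [pow_one] at s6
  generalize theta (x ^ 5) (x ^ 2) = t2 at *
  generalize theta (x ^ 5) (x ^ 4) = t4 at *
  generalize theta (x ^ 5) (x ^ 6) = t6 at *
  generalize theta (x ^ 5) (x ^ 8) = t8 at *
  generalize theta (x ^ 5) (x ^ 12) = t12 at *
  generalize theta (x ^ 5) (x ^ 16) = t16 at *
  linear_combination x * t4 * s8 + x ^ 2 * t6 * s12 + x * t2 * s6 +
    x ^ 5 * t8 * s16 + x ^ 4 * t8 * s6 + x * t4 * s8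

end Dissection

/-! ### The equations for `u` and `v` -/

section Quintic

lemma theta_one_ne_zero {K : Type*} [RCLike K] {q : K} (hq : ‖q‖ < 1) (hq0 : q ≠ 0) :
    theta q 1 ≠ 0 := by
  have hq2 : ‖q ^ 2‖ < 1 := norm_pow_lt_one hq two_ne_zero
  rw [theta_one_eq hq hq0]
  exact mul_ne_zero (poch_ne_zero hq2 hq2) (pow_ne_zero 2 (poch_ne_zero (by rwa [norm_neg]) hq2))

/-- The norm of the five-dissection of the theta series, given a primitive fifth root of unity. -/
lemma theta_one_pow_six_of_isFifth {K : Type*} [RCLike K] {ζ : K} (h : IsFifth ζ) {Q : K}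
    (hQ : ‖Q‖ < 1) (hQ0 : Q ≠ 0) {F a b : K} (hF : F = theta (Q ^ 25) 1)
    (ha : a = Q * theta (Q ^ 25) (Q ^ 10)) (hb : b = Q ^ 4 * theta (Q ^ 25) (Q ^ 20)) :
    F ^ 6 + 32 * F * (a ^ 5 + b ^ 5) - 20 * F ^ 4 * (a * b) + 80 * F ^ 2 * (a * b) ^ 2 =
      theta (Q ^ 5) 1 ^ 6 := by
  have h5 := h.pow_five
  have hζ0 : ζ ≠ 0 := by rintro rfl; norm_num at h5
  have hF0 : F ≠ 0 := by
    rw [hF]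
    exact theta_one_ne_zero (norm_pow_lt_one hQ (by norm_num)) (pow_ne_zero _ hQ0)
  have hn (j : ℕ) : ‖ζ ^ j * Q‖ < 1 := by simpa [h.norm_eq_one] using hQ
  -- `Q ↦ ζ^j Q` fixes `Q^25`, `Q^10`, `Q^20`; only the prefactors `Q` and `Q^4` change.
  have hj (j : ℕ) : theta (ζ ^ j * Q) 1 =
      F * (1 + ζ ^ j * (2 * a / F) + ζ ^ (4 * j) * (2 * b / F)) := by
    have hc (k : ℕ) : (ζ ^ j * Q) ^ (5 * k) = Q ^ (5 * k) := by
      rw [mul_pow, ← pow_mul, show j * (5 * k) = 5 * (j * k) by ring, pow_mul, h5, one_pow, one_mul]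
    rw [theta_one_dissection (hn j) (mul_ne_zero (pow_ne_zero j hζ0) hQ0), hc 5, hc 2, hc 4,
      ← hF, mul_pow, ← pow_mul, mul_comm j 4, mul_assoc (ζ ^ j), mul_assoc (ζ ^ (4 * j)), ← ha,
      ← hb]
    field_simp
  have hprod := prod_theta_one_fifth h hQ hQ0
  rw [Finset.prod_congr rfl fun j _ => hj j, Finset.prod_mul_distrib, prod_one_add_add_fifth h,
    ← pow_mul, ← hF, Finset.prod_const, Finset.card_range] at hprod
  rw [← hprod]
  field_simp
  ring

lemma theta_ofReal (q z : ℝ) : theta (q : ℂ) (z : ℂ) = (theta q z : ℝ) := by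
  simp only [theta]
  push_cast
  rfl

lemma isFifth_exp : IsFifth (Complex.exp (2 * Real.pi * Complex.I / 5)) := by
  have h := (Complex.isPrimitiveRoot_exp 5 (by norm_num)).geom_sum_eq_zero (by norm_num)
  simpa [IsFifth, Finset.sum_range_succ] using h

/-- A primitive `ζ` exists only over `ℂ`; the resulting identity has real terms and descends to `ℝ`.
-/
lemma theta_one_pow_six {Q : ℝ} (hQ : ‖Q‖ < 1) (hQ0 : Q ≠ 0) {F a b : ℝ}
    (hF : F = theta (Q ^ 25) 1) (ha : a = Q * theta (Q ^ 25) (Q ^ 10))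
    (hb : b = Q ^ 4 * theta (Q ^ 25) (Q ^ 20)) :
    F ^ 6 + 32 * F * (a ^ 5 + b ^ 5) - 20 * F ^ 4 * (a * b) + 80 * F ^ 2 * (a * b) ^ 2 =
      theta (Q ^ 5) 1 ^ 6 := by
  have c1 (m : ℕ) : theta ((Q : ℂ) ^ m) 1 = (theta (Q ^ m) 1 : ℝ) := by
    rw [← theta_ofReal]; push_cast; rfl
  have c2 (m l : ℕ) : theta ((Q : ℂ) ^ m) ((Q : ℂ) ^ l) = (theta (Q ^ m) (Q ^ l) : ℝ) := by
    rw [← theta_ofReal]; push_cast; rfl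
  have h := theta_one_pow_six_of_isFifth isFifth_exp (Q := (Q : ℂ)) (F := F) (a := a) (b := b)
    (by simpa using hQ) (by exact_mod_cast hQ0) (by rw [c1, hF]) (by rw [c2, ha]; push_cast; rfl)
    (by rw [c2, hb]; push_cast; rfl)
  rw [c1] at h
  exact_mod_cast h

lemma poch_neg_pos {q : ℝ} (hq0 : 0 < q) (hq : q < 1) : 0 < poch (-q) (q ^ 2) := by
  have hn : ‖q‖ < 1 := by rwa [Real.norm_of_nonneg hq0.le]
  have hn2 := norm_pow_lt_one hn two_ne_zero
  refine lt_of_le_of_ne ?_ (poch_ne_zero (by rwa [norm_neg]) hn2).symm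
  refine ge_of_tendsto' (tendsto_poch (-q) hn2) fun N => Finset.prod_nonneg fun k _ => ?_
  have : 0 ≤ q * (q ^ 2) ^ k := by positivity
  linarith

lemma theta_pos {q z : ℝ} (hq0 : 0 < q) (hq : q < 1) (hz : 0 < z) : 0 < theta q z :=
  (summable_theta (by rwa [Real.norm_of_nonneg hq0.le]) hq0.ne' hz.ne').tsum_pos
    (fun n => by positivity) 0 (by positivity)

/-- The ratio of theta values at `Q` and `Q^25` is `1 + u + v`, where `uv` and `u^5 + v^5` are
polynomials in `p = 4 x χ(x) / χ(x^5)^5`, `x = Q^5`. -/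
lemma exists_theta_ratio {Q p : ℝ} (hQ0 : 0 < Q) (hQ : Q < 1)
    (hp : p = 4 * Q ^ 5 * poch (-(Q ^ 5)) ((Q ^ 5) ^ 2) / poch (-(Q ^ 25)) ((Q ^ 25) ^ 2) ^ 5) :
    ∃ u v : ℝ, 0 < u ∧ 0 < v ∧ u * v = p ∧ u ^ 5 + v ^ 5 = p * (p ^ 2 - 2 * p + 8) ∧
      theta Q 1 / theta (Q ^ 25) 1 = 1 + u + v := by
  have hn : ‖Q‖ < 1 := by rwa [Real.norm_of_nonneg hQ0.le]
  have hlt {m : ℕ} (hm : m ≠ 0) : Q ^ m < 1 := pow_lt_one₀ hQ0.le hQ hm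
  have hx := norm_pow_lt_one hn (show (5 : ℕ) ≠ 0 by norm_num)
  have hx0 : Q ^ 5 ≠ 0 := by positivity
  have e1 := theta_one_dissection hn hQ0.ne'
  have e2 := theta_one_pow_six hn hQ0.ne' rfl rfl rfl
  have e3 := theta_one_sq_sub hx hx0
  have e4 := theta_mul_theta_mul_poch hx hx0
  rw [show (Q ^ 5) ^ 5 = Q ^ 25 by ring, show (Q ^ 5) ^ 4 = Q ^ 20 by ring,
    show (Q ^ 5) ^ 2 = Q ^ 10 by ring] at e3
  rw [show (-(Q ^ 5) ^ 5) = -(Q ^ 25) by ring, show (Q ^ 5) ^ 5 = Q ^ 25 by ring,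
    show (Q ^ 5) ^ 4 = Q ^ 20 by ring, show (Q ^ 5) ^ 10 = (Q ^ 25) ^ 2 by ring] at e4
  have hF := theta_pos (pow_pos hQ0 25) (hlt (by norm_num)) one_pos
  have h2 := theta_pos (pow_pos hQ0 25) (hlt (by norm_num)) (pow_pos hQ0 10)
  have h4 := theta_pos (pow_pos hQ0 25) (hlt (by norm_num)) (pow_pos hQ0 20)
  have hX := poch_neg_pos (pow_pos hQ0 25) (hlt (by norm_num))
  rw [show (Q ^ 5) ^ 2 = Q ^ 10 by ring] at *
  generalize theta (Q ^ 25) 1 = F at *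
  generalize theta (Q ^ 25) (Q ^ 10) = t2 at *
  generalize theta (Q ^ 25) (Q ^ 20) = t4 at *
  generalize theta (Q ^ 5) 1 = T at *
  generalize poch (-(Q ^ 25)) ((Q ^ 25) ^ 2) = X at *
  generalize poch (-(Q ^ 5)) (Q ^ 10) = Y at *
  have hpF : p * F ^ 2 = 4 * Q ^ 5 * (t2 * t4) := by
    rw [hp]
    field_simp
    linear_combination (-1) * e4
  have hT : T ^ 2 = (1 + p) * F ^ 2 := by linear_combination e3 - hpF
  have hT6 : T ^ 6 = (1 + p) ^ 3 * F ^ 6 := by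
    rw [show T ^ 6 = (T ^ 2) ^ 3 by ring, hT]
    ring
  refine ⟨2 * (Q * t2) / F, 2 * (Q ^ 4 * t4) / F, by positivity, by positivity, ?_, ?_, ?_⟩
  · field_simp
    linear_combination (-1) * hpF
  -- Here `(1 + p)^3 - 1 + 5p - 5p^2 = p(p^2 - 2p + 8)`.
  · rw [hT6] at e2
    have hab : Q * t2 * (Q ^ 4 * t4) = p * F ^ 2 / 4 := by linear_combination (-1 / 4) * hpF
    rw [hab] at e2
    have hsum : 32 * ((Q * t2) ^ 5 + (Q ^ 4 * t4) ^ 5) = p * (p ^ 2 - 2 * p + 8) * F ^ 5 := by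
      apply mul_left_cancel₀ hF.ne'
      linear_combination e2
    rw [div_pow, div_pow, ← add_div, div_eq_iff (by positivity)]
    linear_combination hsum
  · rw [e1]
    field_simp

end Quintic

/-- Solving the quadratic for the fifth powers. -/
lemma s_eq_of_fifth_powers {p u v : ℝ} (hu : 0 < u) (hv : 0 < v) (hp : u * v = p)
    (h : u ^ 5 + v ^ 5 = p * (p ^ 2 - 2 * p + 8)) : s p = (1 + u + v) / 5 := by
  have hroot {w : ℝ} (hw : 0 < w) : (w ^ 5) ^ (1 / 5 : ℝ) = w := by
    rw [← Real.rpow_natCast, ← Real.rpow_mul hw.le]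
    norm_num
  have hr : √(4 + p ^ 2) ^ 2 = 4 + p ^ 2 := Real.sq_sqrt (by positivity)
  rw [s]
  generalize √(4 + p ^ 2) = r at hr
  obtain ⟨A, hA⟩ : ∃ A, A = p / 2 * ((p - 1) ^ 2 + 7 + (4 - p) * r) := ⟨_, rfl⟩
  obtain ⟨B, hB⟩ : ∃ B, B = p / 2 * ((p - 1) ^ 2 + 7 - (4 - p) * r) := ⟨_, rfl⟩
  rw [← hA, ← hB]
  have hsum : A + B = u ^ 5 + v ^ 5 := by rw [hA, hB, h]; ring
  have hmul : A * B = u ^ 5 * v ^ 5 := by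
    rw [← mul_pow, hp, hA, hB]
    linear_combination (-(p / 2) ^ 2 * (4 - p) ^ 2) * hr
  -- Equal sums and products force `{A, B} = {u^5, v^5}`; the order is immaterial, as `s` is
  -- symmetric in them.
  have hz : (A - u ^ 5) * (A - v ^ 5) = 0 := by
    linear_combination A * hsum - hmul
  rcases mul_eq_zero.mp hz with h0 | h0
  · have hAu : A = u ^ 5 := by linarith
    have hBv : B = v ^ 5 := by linarith
    rw [hAu, hBv, hroot hu, hroot hv]
    ring
  · have hAv : A = v ^ 5 := by linarith
    have hBu : B = u ^ 5 := by linarith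
    rw [hAv, hBu, hroot hu, hroot hv]
    ring

/-! ### Inversion `t ↦ 1/t` -/

section Inversion

open Real

lemma exp_zpow (c : ℝ) (n : ℤ) : exp c ^ n = exp (n * c) := by
  rw [← Real.rpow_intCast, ← Real.exp_mul, mul_comm]

lemma exp_zpow_sq (c : ℝ) (n : ℤ) : exp c ^ (n ^ 2) = exp (c * (n : ℝ) ^ 2) := by
  rw [exp_zpow]
  push_cast
  ring_nf

lemma theta_one_inversion {t : ℝ} (ht : 0 < t) :
    theta (exp (-π * t)) 1 = (√t)⁻¹ * theta (exp (-π / t)) 1 := by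
  have h := Real.tsum_exp_neg_mul_int_sq ht
  simp only [theta, one_zpow, mul_one, exp_zpow_sq]
  rw [h, ← Real.sqrt_eq_rpow, one_div]

/-- Poisson summation turns the character `(-1)^n` into the shift `n ↦ n - 1/2`; expanding the
square gives the factor `e^(-π/(4t))` and `z = q⁻¹`, which `theta_inv` replaces by `q`. -/
lemma theta_neg_one_inversion {t : ℝ} (ht : 0 < t) :
    theta (exp (-π * t)) (-1) =
      (√t)⁻¹ * exp (-π / t / 4) * theta (exp (-π / t)) (exp (-π / t)) := by
  have h := Complex.tsum_exp_neg_quadratic (a := (t : ℂ)) (by simpa using ht) (Complex.I / 2)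
  rw [← theta_inv (exp (-π / t)) (exp (-π / t))]
  have hl (n : ℤ) : Complex.exp (-π * t * n ^ 2 + 2 * π * (Complex.I / 2) * n) =
      ((exp (-π * t) ^ (n ^ 2) * (-1) ^ n : ℝ) : ℂ) := by
    rw [Complex.exp_add, exp_zpow_sq, show 2 * π * (Complex.I / 2) * n = n * (π * Complex.I) by ring,
      Complex.exp_int_mul, Complex.exp_pi_mul_I]
    push_cast
    rfl
  have hr (n : ℤ) : Complex.exp (-π / t * (n + Complex.I * (Complex.I / 2)) ^ 2) =
      ((exp (-π / t / 4) * (exp (-π / t) ^ (n ^ 2) * (exp (-π / t))⁻¹ ^ n) : ℝ) : ℂ) := by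
    rw [exp_zpow_sq, ← Real.exp_neg, exp_zpow, ← Real.exp_add, ← Real.exp_add,
      Complex.ofReal_exp]
    congr 1
    rw [show Complex.I * (Complex.I / 2) = -1 / 2 by linear_combination Complex.I_mul_I / 2]
    push_cast
    ring
  simp only [hl, hr] at h
  rw [← Complex.ofReal_tsum, ← Complex.ofReal_tsum, tsum_mul_left, ← theta, ← theta] at h
  have hs : (1 : ℂ) / (t : ℂ) ^ (1 / 2 : ℂ) = (((√t)⁻¹ : ℝ) : ℂ) := by
    rw [Real.sqrt_eq_rpow, Complex.ofReal_inv, Complex.ofReal_cpow ht.le, one_div]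
    push_cast
    rfl
  rw [hs] at h
  rw [mul_assoc]
  exact_mod_cast h

/-- The normalised product `q^(-1/24) χ(q)` at `q = e^(-π t)`. -/
def chiNorm (t : ℝ) : ℝ := exp (π * t / 24) * chi (exp (-π * t))

lemma chiNorm_inv {t : ℝ} (ht : 0 < t) : chiNorm (1 / t) = chiNorm t := by
  have hq0 : 0 < exp (-π * t) := exp_pos _
  have hq : exp (-π * t) < 1 := Real.exp_lt_one_iff.mpr (by nlinarith [pi_pos])
  have hq0' : 0 < exp (-π / t) := exp_pos _
  have hq' : exp (-π / t) < 1 := Real.exp_lt_one_iff.mpr (div_neg_of_neg_of_pos (by linarith [pi_pos]) ht)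
  have n1 : ‖exp (-π * t)‖ < 1 := by rwa [Real.norm_of_nonneg hq0.le]
  have n2 : ‖exp (-π / t)‖ < 1 := by rwa [Real.norm_of_nonneg hq0'.le]
  have h1 := poch_neg_pow_six_mul n1 hq0.ne'
  have h2 := poch_neg_pow_six_mul n2 hq0'.ne'
  have i1 := theta_one_inversion ht
  have i2 := theta_neg_one_inversion ht
  have i3 := theta_neg_one_inversion (t := 1 / t) (by positivity)
  rw [show -π * (1 / t) = -π / t by ring, show -π / (1 / t) = -π * t by field_simp,
    Real.sqrt_div zero_le_one, Real.sqrt_one, one_div, inv_inv] at i3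
  have p1 := poch_neg_pos hq0 hq
  have p2 := poch_neg_pos hq0' hq'
  have q1 := theta_pos hq0 hq hq0
  have q2 := theta_pos hq0' hq' hq0'
  have hst : 0 < √t := Real.sqrt_pos.mpr ht
  have hchi1 : chi (exp (-π * t)) = poch (-exp (-π * t)) (exp (-π * t) ^ 2) := rfl
  have hchi2 : chi (exp (-π / t)) = poch (-exp (-π / t)) (exp (-π / t) ^ 2) := rfl
  have key : chi (exp (-π / t)) ^ 6 * exp (-π * t / 4) = chi (exp (-π * t)) ^ 6 * exp (-π / t / 4) := by
    rw [hchi1, hchi2]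
    rw [i2] at h1
    rw [i3] at h2
    rw [i1] at h1
    generalize exp (-π / t / 4) = e at *
    generalize theta (exp (-π / t)) 1 = F at *
    generalize theta (exp (-π * t)) (exp (-π * t)) = a at *
    generalize theta (exp (-π / t)) (exp (-π / t)) = b at *
    generalize poch (-exp (-π / t)) (exp (-π / t) ^ 2) = X at *
    generalize poch (-exp (-π * t)) (exp (-π * t) ^ 2) = Y at *
    field_simp at h1
    apply mul_left_cancel₀ (mul_pos (mul_pos q1 q2) hst).ne'
    linear_combination h2 - h1
  rw [chiNorm, chiNorm, show -π * (1 / t) = -π / t by ring]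
  -- Both sides are positive, so sixth powers suffice; then `6/24 = 1/4` matches the exponentials in
  -- `key`.
  rw [← pow_left_inj₀ (n := 6) (by rw [hchi2]; positivity) (by rw [hchi1]; positivity)
    (by norm_num), mul_pow, mul_pow, ← Real.exp_nat_mul, ← Real.exp_nat_mul]
  have k1 : exp (-π * t / 4) * exp (((6 : ℕ) : ℝ) * (π * t / 24)) = 1 := by
    rw [← Real.exp_add, Real.exp_eq_one_iff]; push_cast; ring
  have k2 : exp (-π / t / 4) * exp (((6 : ℕ) : ℝ) * (π * (1 / t) / 24)) = 1 := by
    rw [← Real.exp_add, Real.exp_eq_one_iff]; push_cast; ring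
  generalize exp (((6 : ℕ) : ℝ) * (π * (1 / t) / 24)) = A at *
  generalize exp (((6 : ℕ) : ℝ) * (π * t / 24)) = B at *
  linear_combination A * B * key - A * chi (exp (-π / t)) ^ 6 * k1 +
    B * chi (exp (-π * t)) ^ 6 * k2

lemma classInvariant_eq (n : ℝ) :
    classInvariant n = (2 : ℝ) ^ (-(1 / 4) : ℝ) * chiNorm (√n) := by
  rw [classInvariant, chiNorm, ← Real.exp_mul, mul_assoc]
  congr 3
  ring

end Inversion

/-! ### Class invariants and the final formula -/

lemma phi_eq_theta (q : ℝ) : phi q = theta q 1 := by simp [phi, theta]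

open Real in
/-- The parameter `p = 2 G_{25n} / G_n^5` in terms of the inverted nome. -/
lemma two_mul_classInvariant_div {n t : ℝ} (ht : 0 < t) (hn : √n = t) :
    2 * classInvariant (25 * n) / classInvariant n ^ 5 =
      4 * exp (-π / (5 * t)) * chi (exp (-π / (5 * t))) / chi (exp (-π / t)) ^ 5 := by
  have h25 : √(25 * n) = 5 * t := by
    rw [Real.sqrt_mul (by norm_num), hn, show (25 : ℝ) = 5 ^ 2 by norm_num,
      Real.sqrt_sq (by norm_num)]
  -- The constant is `2c/c^5 = 2/c^4 = 4` for `c = 2^(-1/4)`.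
  have h2 : ((2 : ℝ) ^ (-(1 / 4) : ℝ)) ^ 4 = 1 / 2 := by
    rw [← Real.rpow_natCast, ← Real.rpow_mul (by norm_num)]
    norm_num
  have h20 : (2 : ℝ) ^ (-(1 / 4) : ℝ) ≠ 0 := by positivity
  rw [classInvariant_eq, classInvariant_eq, h25, hn, ← chiNorm_inv ht,
    ← chiNorm_inv (show 0 < 5 * t by positivity), chiNorm, chiNorm,
    show -π * (1 / t) = -π / t by ring, show -π * (1 / (5 * t)) = -π / (5 * t) by ring]
  have hq0' : 0 < exp (-π / t) := exp_pos _
  have hq' : exp (-π / t) < 1 := Real.exp_lt_one_iff.mpr (div_neg_of_neg_of_pos (by linarith [pi_pos]) ht)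
  have hX : chi (exp (-π / t)) ≠ 0 := (poch_neg_pos hq0' hq').ne'
  -- Since `1/120 = -1/5 + 5/24`; the surplus is the factor `x`.
  have hexp : exp (π * (1 / (5 * t)) / 24) =
      exp (-π / (5 * t)) * exp (π * (1 / t) / 24) ^ 5 := by
    rw [← Real.exp_nat_mul, ← Real.exp_add]
    congr 1
    push_cast
    field_simp
    ring
  have he : exp (π * (1 / t) / 24) ≠ 0 := (exp_pos _).ne'
  rw [hexp]
  generalize (2 : ℝ) ^ (-(1 / 4) : ℝ) = c at *
  generalize exp (π * (1 / t) / 24) = E at *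
  generalize chi (exp (-π / t)) = X at *
  rw [div_eq_div_iff (by positivity) (by positivity)]
  linear_combination (-4 * exp (-π / (5 * t)) * chi (exp (-π / (5 * t))) * X ^ 5 * E ^ 5 * c) * h2

end

end RamanujanTheta

theorem theorem5p3 (n : ℚ) (hn : 0 < n) :
    RamanujanTheta.phi (Real.exp (-25 * Real.pi * √(n : ℝ))) /
        RamanujanTheta.phi (Real.exp (-Real.pi * √(n : ℝ))) =
      RamanujanTheta.s
        (2 * RamanujanTheta.classInvariant (25 * (n : ℝ)) /
          RamanujanTheta.classInvariant (n : ℝ) ^ 5) := by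
  obtain ⟨t, hnt⟩ : ∃ t, √(n : ℝ) = t := ⟨_, rfl⟩
  have ht : 0 < t := by
    rw [← hnt]
    exact Real.sqrt_pos.mpr (by exact_mod_cast hn)
  rw [RamanujanTheta.two_mul_classInvariant_div ht hnt, hnt, RamanujanTheta.phi_eq_theta,
    RamanujanTheta.phi_eq_theta]
  have hpi := Real.pi_pos
  obtain ⟨Q, hQ⟩ : ∃ Q, Q = Real.exp (-Real.pi / (25 * t)) := ⟨_, rfl⟩
  have hQ1 : Q < 1 := by
    rw [hQ]
    exact Real.exp_lt_one_iff.mpr (div_neg_of_neg_of_pos (by linarith) (by positivity))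
  have hQ5 : Real.exp (-Real.pi / (5 * t)) = Q ^ 5 := by
    rw [hQ, ← Real.exp_nat_mul]
    congr 1
    push_cast
    field_simp
    norm_num
  have hQ25 : Real.exp (-Real.pi / t) = Q ^ 25 := by
    rw [hQ, ← Real.exp_nat_mul]
    congr 1
    push_cast
    field_simp
  have hQ0 : 0 < Q := by rw [hQ]; exact Real.exp_pos _
  obtain ⟨u, v, hu, hv, huv, hsum, hratio⟩ := RamanujanTheta.exists_theta_ratio hQ0 hQ1 rfl
  have hs := RamanujanTheta.s_eq_of_fifth_powers hu hv huv hsum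
  have i1 := RamanujanTheta.theta_one_inversion ht
  -- Here `√(25t) = 5√t` supplies the prefactor `1/5` of `s`.
  have i25 := RamanujanTheta.theta_one_inversion (show 0 < 25 * t by positivity)
  rw [hQ25] at i1
  rw [← hQ, Real.sqrt_mul (by norm_num), show (25 : ℝ) = 5 ^ 2 by norm_num,
    Real.sqrt_sq (by norm_num), show -Real.pi * (5 ^ 2 * t) = -25 * Real.pi * t by ring] at i25
  rw [hQ5, hQ25]
  -- `chi` in the goal and `poch` in `hs` agree by unfolding.
  refine Eq.trans ?_ hs.symm
  rw [i1, i25, ← hratio]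
  have hst : 0 < √t := Real.sqrt_pos.mpr ht
  have hF : RamanujanTheta.theta (Q ^ 25) 1 ≠ 0 :=
    (RamanujanTheta.theta_pos (pow_pos hQ0 25) (pow_lt_one₀ hQ0.le hQ1 (by norm_num)) one_pos).ne'
  field_simp
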